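/- Let $a$, $b$, $c$ be finite-dimensional quantum systems with $\dim a\ge 2$, let $\rho$ be a state (density matrix) of the bipartite system $ab$, and let $\Phi$ be a completely positive trace-preserving (CPTP) linear map from operators on $b$ to operators on $c$ (for instance $c=b$). Fix a measurement strength $x\in\mathbb R$ and put $\tau_1=\sqrt{(1-\tanh x)/2}$, $\tau_2=\sqrt{(1+\tanh x)/2}$. A weak measurement $\Omega$ of strength $x$ on $a$ is given by two nonzero orthogonal projectors $\Pi^1,\Pi^2$ on $a$ with $\Pi^1+\Pi^2=\mathbb 1$, through $\Omega_x=\tau_1\Pi^1+\tau_2\Pi^2$, $\Omega_{-x}=\tau_2\Pi^1+\tau_1\Pi^2$ and $\Omega(X)=\sum_{k=\pm x}(\Omega_k\otimes\mathbb 1)X(\Omega_k\otimes\mathbb 1)$. For a bipartite state $\sigma$ with marginals $\sigma^a,\sigma^b$ put $$C_H(\sigma|\Omega)=\|\sqrt\sigma-\Omega(\sqrt\sigma)\|^2,\qquad \Delta_w(\sigma|\Omega)=C_H(\sigma|\Omega)-C_H(\sigma^a\otimes\sigma^b|\Omega),\qquad \mathcal Q_w(\sigma)=\min_\Omega\Delta_w(\sigma|\Omega),$$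 where $\|O\|=\sqrt{\operatorname{tr}(O^\dagger O)}$ is the Hilbert–Schmidt norm and the minimum is over all weak measurements $\Omega$ of strength $x$ on $a$. Then the minima defining $\mathcal Q_w(\rho)$ and $\mathcal Q_w((\mathbb 1\otimes\Phi)\rho)$ are attained, and $$\mathcal Q_w\big((\mathbb 1\otimes\Phi)\rho\big)\le\mathcal Q_w(\rho).$$ -/

import Mathlib

namespace WeakCorrelation

open scoped Kronecker MatrixOrder ComplexOrder

noncomputable section

/-- A density matrix (quantum state): positive semidefinite with unit trace. -/
def IsState {n : Type*} [Fintype n] (ρ : Matrix n n ℂ) : Prop :=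
  ρ.PosSemidef ∧ ρ.trace = 1

/-- The marginal on the first subsystem (partial trace over the second one). -/
def marginalA {a b : Type*} [Fintype b] (ρ : Matrix (a × b) (a × b) ℂ) : Matrix a a ℂ :=
  Matrix.of fun i i' => ∑ j, ρ (i, j) (i', j)

/-- The marginal on the second subsystem (partial trace over the first one). -/
def marginalB {a b : Type*} [Fintype a] (ρ : Matrix (a × b) (a × b) ℂ) : Matrix b b ℂ :=
  Matrix.of fun j j' => ∑ i, ρ (i, j) (i, j')

/-- The map `1 ⊗ Φ`: `Φ` is applied to every block `(X (i, ·) (i', ·))`, so that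
`(1 ⊗ Φ) (A ⊗ B) = A ⊗ Φ B`. -/
def idTensor (a : Type*) {b c : Type*} (Φ : Matrix b b ℂ →ₗ[ℂ] Matrix c c ℂ)
    (X : Matrix (a × b) (a × b) ℂ) : Matrix (a × c) (a × c) ℂ :=
  Matrix.of fun p q => Φ (Matrix.of fun j j' => X (p.1, j) (q.1, j')) p.2 q.2

/-- Completely positive and trace preserving linear maps. -/
structure IsCPTP {b c : Type*} [Fintype b] [Fintype c]
    (Φ : Matrix b b ℂ →ₗ[ℂ] Matrix c c ℂ) : Prop where
  completelyPositive : ∀ (k : ℕ) (X : Matrix (Fin k × b) (Fin k × b) ℂ),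
    X.PosSemidef → (idTensor (Fin k) Φ X).PosSemidef
  tracePreserving : ∀ X : Matrix b b ℂ, (Φ X).trace = X.trace

/-- The Hilbert-Schmidt norm `√(tr (O† O))`. -/
def hsNorm {n : Type*} [Fintype n] (O : Matrix n n ℂ) : ℝ :=
  Real.sqrt (Matrix.trace (O.conjTranspose * O)).re

/-- Two nonzero orthogonal projectors which add up to the identity. -/
structure IsProjectorPair {a : Type*} [Fintype a] [DecidableEq a]
    (P Q : Matrix a a ℂ) : Prop where
  left_proj : IsStarProjection P
  right_proj : IsStarProjection Q
  add_eq_one : P + Q = 1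
  left_ne_zero : P ≠ 0
  right_ne_zero : Q ≠ 0

/-- `τ₁ = √((1 - tanh x) / 2)`. -/
def tau1 (x : ℝ) : ℝ := Real.sqrt ((1 - Real.tanh x) / 2)

/-- `τ₂ = √((1 + tanh x) / 2)`. -/
def tau2 (x : ℝ) : ℝ := Real.sqrt ((1 + Real.tanh x) / 2)

/-- The weak measurement operator `Ω_x = τ₁ P + τ₂ Q`. -/
def weakPlus {a : Type*} (x : ℝ) (P Q : Matrix a a ℂ) : Matrix a a ℂ :=
  (tau1 x : ℂ) • P + (tau2 x : ℂ) • Q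

/-- The weak measurement operator `Ω_{-x} = τ₂ P + τ₁ Q`. -/
def weakMinus {a : Type*} (x : ℝ) (P Q : Matrix a a ℂ) : Matrix a a ℂ :=
  (tau2 x : ℂ) • P + (tau1 x : ℂ) • Q

/-- The weak measurement on subsystem `a` of a bipartite system:
`Ω(X) = ∑_{k = ±x} (Ω_k ⊗ 1) X (Ω_k ⊗ 1)`. -/
def weakMeasure {a b : Type*} [Fintype a] [Fintype b] [DecidableEq b] (x : ℝ)
    (P Q : Matrix a a ℂ) (X : Matrix (a × b) (a × b) ℂ) : Matrix (a × b) (a × b) ℂ :=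
  (weakPlus x P Q ⊗ₖ (1 : Matrix b b ℂ)) * X * (weakPlus x P Q ⊗ₖ (1 : Matrix b b ℂ)) +
  (weakMinus x P Q ⊗ₖ (1 : Matrix b b ℂ)) * X * (weakMinus x P Q ⊗ₖ (1 : Matrix b b ℂ))

/-- The coherence relative to a weak measurement, `C_H(ρ|Ω) = ‖√ρ - Ω(√ρ)‖²`. -/
def coherence {a b : Type*} [Fintype a] [DecidableEq a] [Fintype b] [DecidableEq b] (x : ℝ)
    (P Q : Matrix a a ℂ) (ρ : Matrix (a × b) (a × b) ℂ) : ℝ :=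
  hsNorm (CFC.sqrt ρ - weakMeasure x P Q (CFC.sqrt ρ)) ^ 2

/-- The correlation function `Δ_w(ρ|Ω) = C_H(ρ|Ω) - C_H(ρᵃ ⊗ ρᵇ|Ω)`. -/
def Delta {a b : Type*} [Fintype a] [DecidableEq a] [Fintype b] [DecidableEq b] (x : ℝ)
    (P Q : Matrix a a ℂ) (ρ : Matrix (a × b) (a × b) ℂ) : ℝ :=
  coherence x P Q ρ - coherence x P Q (marginalA ρ ⊗ₖ marginalB ρ)

/-- All values of `Δ_w(ρ|Ω)`, where `Ω` runs over the weak measurements of strength `x` on `a`. -/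
def DeltaValues {a b : Type*} [Fintype a] [DecidableEq a] [Fintype b] [DecidableEq b] (x : ℝ)
    (ρ : Matrix (a × b) (a × b) ℂ) : Set ℝ :=
  {r | ∃ P Q : Matrix a a ℂ, IsProjectorPair P Q ∧ r = Delta x P Q ρ}

/-- The quantum correlation `Q_w(ρ) = min_Ω Δ_w(ρ|Ω)` at measurement strength `x`. -/
def Qw {a b : Type*} [Fintype a] [DecidableEq a] [Fintype b] [DecidableEq b] (x : ℝ)
    (ρ : Matrix (a × b) (a × b) ℂ) : ℝ :=
  sInf (DeltaValues x ρ)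

end

end WeakCorrelation

/-!
For a projector pair `(P, Q)` the part of `√ρ` removed by a weak measurement is, up to the factor
`1 - 2 τ₁ τ₂` and the unitary `2 P - 1`, the commutator of `P ⊗ 1` with `√ρ`. Hence the coherence
is a multiple of the Wigner–Yanase skew information of `P ⊗ 1`, and the coherence of the product of
the marginals depends only on `ρᵃ` and `tr ρ`, neither of which is changed by `1 ⊗ Φ`. So it
suffices that the skew information of `P ⊗ 1` decreases under `1 ⊗ Φ`, which fixes every `A ⊗ 1` in
the Heisenberg picture. This is Lieb's inequality with exponent `1/2`: the Kadison–Schwarz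
inequality bounds left multiplication by `√ρ` and right multiplication by `√ρ` separately, after
composition with the dual map, by the corresponding multiplications by `√(Φ ρ)`; as left and right
multiplications commute, operator monotonicity of the square root bounds their products as well.
The minima are attained because the projector pairs form a nonempty compact set.
-/

namespace WeakCorrelation

open scoped Kronecker MatrixOrder ComplexOrder InnerProductSpace
open Filter Topology

/-! ### Products of commuting positive operators -/

section Operators

open ContinuousLinearMap

variable {H K : Type*} [NormedAddCommGroup H] [InnerProductSpace ℂ H]
  [NormedAddCommGroup K] [InnerProductSpace ℂ K]

theorem norm_apply_le_norm_add_smul_one_apply {B : H →L[ℂ] H} (hB : B.IsPositive) {ε : ℝ}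
    (hε : 0 ≤ ε) (y : H) : ‖B y‖ ≤ ‖(B + ε • (1 : H →L[ℂ] H)) y‖ := by
  have hadd : ‖(B + ε • (1 : H →L[ℂ] H)) y‖ ^ 2 =
      ‖B y‖ ^ 2 + 2 * (ε * RCLike.re ⟪B y, y⟫_ℂ) + ‖ε • y‖ ^ 2 := by
    rw [add_apply, smul_apply, one_apply_eq_self, norm_add_sq (𝕜 := ℂ), ← Complex.coe_smul,
      inner_smul_right]
    simp
  have hcross : 0 ≤ ε * RCLike.re ⟪B y, y⟫_ℂ := mul_nonneg hε (hB.re_inner_nonneg_left y)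
  refine (sq_le_sq₀ (norm_nonneg _) (norm_nonneg _)).1 ?_
  rw [hadd]
  linarith [sq_nonneg ‖ε • y‖]

variable [CompleteSpace H] [CompleteSpace K]

theorem star_mul_self_le_star_mul_self_of_norm_apply_le {C D : H →L[ℂ] H}
    (h : ∀ x, ‖C x‖ ≤ ‖D x‖) : star C * C ≤ star D * D := by
  rw [ContinuousLinearMap.le_def, ContinuousLinearMap.isPositive_def']
  refine ⟨(IsSelfAdjoint.star_mul_self D).sub (IsSelfAdjoint.star_mul_self C), fun x => ?_⟩
  have hx := pow_le_pow_left₀ (norm_nonneg _) (h x) 2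
  simpa [reApplyInnerSelf_apply, inner_sub_left, star_eq_adjoint, adjoint_inner_left,
    inner_self_eq_norm_sq_to_K, ← Complex.ofReal_pow] using hx

theorem le_of_norm_apply_le {C D : H →L[ℂ] H} (hC : IsSelfAdjoint C) (hD : 0 ≤ D)
    (h : ∀ x, ‖C x‖ ≤ ‖D x‖) : C ≤ D :=
  calc C ≤ CFC.abs C := sub_nonneg.1 <| by
        rw [CFC.abs_sub_self C hC]
        exact smul_nonneg zero_le_two (CFC.negPart_nonneg C)
    _ ≤ CFC.abs D := CFC.sqrt_le_sqrt _ _ (star_mul_self_le_star_mul_self_of_norm_apply_le h)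
    _ = D := CFC.abs_of_nonneg D hD

theorem le_mul_units_of_norm_inner_le {T A : H →L[ℂ] H} {B : (H →L[ℂ] H)ˣ} (hT : IsSelfAdjoint T)
    (hA : 0 ≤ A) (hB : 0 ≤ (B : H →L[ℂ] H)) (hAB : Commute A B)
    (h : ∀ x y, ‖⟪x, T y⟫_ℂ‖ ≤ ‖A x‖ * ‖(B : H →L[ℂ] H) y‖) : T ≤ A * B := by
  -- Testing the bound at `(B⁻¹ x, B⁻¹ y)` with `y = B⁻¹ T B⁻¹ x` gives `‖B⁻¹ T B⁻¹ x‖ ≤ ‖A B⁻¹ x‖`,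
  -- from which operator monotonicity of the square root removes the norms.
  set J : H →L[ℂ] H := ↑B⁻¹ with hJ
  have hJ_nonneg : 0 ≤ J := CFC.inv_nonneg_of_nonneg B hB
  have hJ_adjoint : adjoint J = J := (IsSelfAdjoint.of_nonneg hJ_nonneg).star_eq
  have hC : IsSelfAdjoint (J * T * J) := by
    simpa only [(IsSelfAdjoint.of_nonneg hJ_nonneg).star_eq] using hT.conjugate J
  have hC_norm (x : H) : ‖(J * T * J) x‖ ≤ ‖(A * J) x‖ := by
    set y := (J * T * J) x
    have hB_J : (B : H →L[ℂ] H) (J y) = y := by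
      rw [← mul_apply_eq_comp, hJ, B.mul_inv, one_apply_eq_self]
    have hyy : ⟪J x, T (J y)⟫_ℂ = (‖y‖ : ℂ) ^ 2 :=
      calc ⟪J x, T (J y)⟫_ℂ = ⟪x, (J * T * J) y⟫_ℂ := by
            rw [← adjoint_inner_right, hJ_adjoint]; rfl
        _ = ⟪y, y⟫_ℂ := by rw [← adjoint_inner_left, ← star_eq_adjoint, hC.star_eq]
        _ = (‖y‖ : ℂ) ^ 2 := inner_self_eq_norm_sq_to_K y
    have hsq := h (J x) (J y)
    rw [hyy, hB_J, norm_pow, Complex.norm_real, norm_norm, sq] at hsq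
    rcases (norm_nonneg y).eq_or_lt with hy0 | hy0
    · exact hy0 ▸ norm_nonneg _
    · exact le_of_mul_le_mul_right hsq hy0
  have hC_le : J * T * J ≤ A * J :=
    le_of_norm_apply_le hC (hAB.units_inv_right.mul_nonneg hA hJ_nonneg) hC_norm
  calc T = B * (J * T * J) * B := by simp [hJ, mul_assoc]
    _ ≤ B * (A * J) * B := conjugate_le_conjugate_of_nonneg hC_le hB
    _ = A * B := by simp [hJ, mul_assoc, hAB.eq]

theorem le_mul_of_norm_inner_le {T A B : H →L[ℂ] H} (hT : IsSelfAdjoint T) (hA : 0 ≤ A)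
    (hB : 0 ≤ B) (hAB : Commute A B) (h : ∀ x y, ‖⟪x, T y⟫_ℂ‖ ≤ ‖A x‖ * ‖B y‖) : T ≤ A * B := by
  have hlim : Tendsto (fun ε : ℝ => A * (B + ε • (1 : H →L[ℂ] H))) (𝓝[>] 0) (𝓝 (A * B)) := by
    have hcont : Continuous fun ε : ℝ => A * (B + ε • (1 : H →L[ℂ] H)) := by fun_prop
    simpa using (hcont.tendsto 0).mono_left nhdsWithin_le_nhds
  refine ge_of_tendsto hlim ?_
  filter_upwards [self_mem_nhdsWithin] with ε hε
  have hpos : IsStrictlyPositive (B + ε • (1 : H →L[ℂ] H)) :=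
    IsStrictlyPositive.nonneg_add hB (isStrictlyPositive_one.smul hε)
  obtain ⟨u, hu⟩ := hpos.isUnit
  rw [← hu] at hpos ⊢
  refine le_mul_units_of_norm_inner_le hT hA hpos.nonneg ?_ fun x y => (h x y).trans ?_
  · rw [hu]
    exact hAB.add_right ((Commute.one_right A).smul_right ε)
  · rw [hu]
    gcongr
    exact norm_apply_le_norm_add_smul_one_apply ((nonneg_iff_isPositive B).1 hB) (le_of_lt hε) y

theorem adjoint_conj_mul_le_mul {V : H →L[ℂ] K} {L R : K →L[ℂ] K} {A B : H →L[ℂ] H}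
    (hL : IsSelfAdjoint L) (hR : IsSelfAdjoint R) (hLR : Commute L R) (hA : 0 ≤ A) (hB : 0 ≤ B)
    (hAB : Commute A B) (hLA : ∀ x, ‖L (V x)‖ ≤ ‖A x‖) (hRB : ∀ x, ‖R (V x)‖ ≤ ‖B x‖) :
    adjoint V ∘L (L * R) ∘L V ≤ A * B := by
  have hLR_adj : IsSelfAdjoint (L * R) := (IsSelfAdjoint.commute_iff hL hR).1 hLR
  refine le_mul_of_norm_inner_le (hLR_adj.adjoint_conj V) hA hB hAB fun x y => ?_
  calc ‖⟪x, (adjoint V ∘L (L * R) ∘L V) y⟫_ℂ‖ = ‖⟪L (V x), R (V y)⟫_ℂ‖ := by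
        rw [comp_apply, adjoint_inner_right, comp_apply, mul_apply_eq_comp, ← adjoint_inner_left,
          ← star_eq_adjoint, hL.star_eq]
    _ ≤ ‖L (V x)‖ * ‖R (V y)‖ := norm_inner_le_norm _ _
    _ ≤ ‖A x‖ * ‖B y‖ := by gcongr <;> simp only [hLA, hRB]

end Operators

section LinearMaps

variable {H K : Type*} [NormedAddCommGroup H] [InnerProductSpace ℂ H] [FiniteDimensional ℂ H]
  [NormedAddCommGroup K] [InnerProductSpace ℂ K] [FiniteDimensional ℂ K]

open ContinuousLinearMap in
theorem re_inner_mul_le_re_inner_mul {V : H →ₗ[ℂ] K} {L R : K →ₗ[ℂ] K} {A B : H →ₗ[ℂ] H}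
    (hL : L.IsSymmetric) (hR : R.IsSymmetric) (hLR : Commute L R) (hA : A.IsPositive)
    (hB : B.IsPositive) (hAB : Commute A B) (hLA : ∀ x, ‖L (V x)‖ ≤ ‖A x‖)
    (hRB : ∀ x, ‖R (V x)‖ ≤ ‖B x‖) (x : H) :
    RCLike.re ⟪V x, L (R (V x))⟫_ℂ ≤ RCLike.re ⟪x, A (B x)⟫_ℂ := by
  have := FiniteDimensional.complete ℂ H
  have := FiniteDimensional.complete ℂ K
  have hle := adjoint_conj_mul_le_mul (V := V.toContinuousLinearMap)
    (isSelfAdjoint_iff_isSymmetric (A := L.toContinuousLinearMap) |>.2 hL)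
    (isSelfAdjoint_iff_isSymmetric (A := R.toContinuousLinearMap) |>.2 hR)
    (hLR.map (Module.End.toContinuousLinearMap K))
    ((nonneg_iff_isPositive _).2 (A.isPositive_toContinuousLinearMap_iff.2 hA))
    ((nonneg_iff_isPositive _).2 (B.isPositive_toContinuousLinearMap_iff.2 hB))
    (hAB.map (Module.End.toContinuousLinearMap H)) hLA hRB
  have hx := ((ContinuousLinearMap.le_def _ _).1 hle).re_inner_nonneg_right x
  rw [sub_apply, inner_sub_right, map_sub, sub_nonneg] at hx
  simpa [adjoint_inner_right] using hx

end LinearMaps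

open Matrix

/-! ### Left and right multiplication on Hilbert–Schmidt space -/

section HilbertSchmidt

variable {m n : Type*} [Fintype m] [Fintype n]

attribute [local instance] Matrix.frobeniusNormedAddCommGroup Matrix.frobeniusNormedSpace

theorem frobenius_norm_sq (X : Matrix m n ℂ) : ‖X‖ ^ 2 = (Xᴴ * X).trace.re := by
  rw [frobenius_norm_def, ← Real.rpow_mul_natCast (by positivity), Finset.sum_comm]
  simp [trace, mul_apply, ← Complex.normSq_eq_norm_sq, ← Complex.normSq_eq_conj_mul_self]

theorem frobenius_norm_le_iff {m' n' : Type*} [Fintype m'] [Fintype n'] {X : Matrix m n ℂ}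
    {Y : Matrix m' n' ℂ} : ‖X‖ ≤ ‖Y‖ ↔ (Xᴴ * X).trace.re ≤ (Yᴴ * Y).trace.re := by
  rw [← frobenius_norm_sq, ← frobenius_norm_sq, sq_le_sq₀ (norm_nonneg _) (norm_nonneg _)]

/-- The Hilbert–Schmidt inner product `⟪X, Y⟫ = tr (X† Y)`, which makes matrices a Hilbert space on
which left and right multiplications act as commuting operators. Its norm is definitionally the
Frobenius norm of Mathlib. -/
noncomputable abbrev hilbertSchmidtInner : InnerProductSpace ℂ (Matrix m n ℂ) where
  inner X Y := (Xᴴ * Y).trace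
  norm_sq_eq_re_inner := frobenius_norm_sq
  conj_inner_symm X Y := by
    rw [starRingEnd_apply, ← trace_conjTranspose, conjTranspose_mul, conjTranspose_conjTranspose]
  add_left X Y Z := by rw [conjTranspose_add, Matrix.add_mul, trace_add]
  smul_left X Y r := by rw [conjTranspose_smul, Matrix.smul_mul, trace_smul]; rfl

attribute [local instance] hilbertSchmidtInner

theorem inner_eq_trace (X Y : Matrix m n ℂ) : ⟪X, Y⟫_ℂ = (Xᴴ * Y).trace := rfl

theorem isSymmetric_mulLeft {S : Matrix m m ℂ} (hS : S.IsHermitian) :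
    (mulLeftLinearMap n ℂ S).IsSymmetric := fun X Y => by
  simp only [mulLeftLinearMap_apply, inner_eq_trace, conjTranspose_mul, hS.eq, Matrix.mul_assoc]

theorem isSymmetric_mulRight {S : Matrix n n ℂ} (hS : S.IsHermitian) :
    (mulRightLinearMap m ℂ S).IsSymmetric := fun X Y => by
  rw [mulRightLinearMap_apply, mulRightLinearMap_apply, inner_eq_trace, inner_eq_trace,
    conjTranspose_mul, hS.eq, Matrix.mul_assoc, trace_mul_comm, Matrix.mul_assoc]

theorem isPositive_mulLeft {S : Matrix m m ℂ} (hS : S.PosSemidef) :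
    (mulLeftLinearMap n ℂ S).IsPositive := by
  refine ⟨isSymmetric_mulLeft hS.isHermitian, fun X => ?_⟩
  rw [isSymmetric_mulLeft hS.isHermitian, mulLeftLinearMap_apply, inner_eq_trace,
    ← Matrix.mul_assoc]
  exact (Complex.nonneg_iff.1 (hS.conjTranspose_mul_mul_same X).trace_nonneg).1

theorem isPositive_mulRight {S : Matrix n n ℂ} (hS : S.PosSemidef) :
    (mulRightLinearMap m ℂ S).IsPositive := by
  refine ⟨isSymmetric_mulRight hS.isHermitian, fun X => ?_⟩
  rw [isSymmetric_mulRight hS.isHermitian, mulRightLinearMap_apply, inner_eq_trace, trace_mul_comm]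
  exact (Complex.nonneg_iff.1 (hS.mul_mul_conjTranspose_same X).trace_nonneg).1

theorem re_trace_conjTranspose_mul_mul_mul_le {m₁ m₂ n₁ n₂ : Type*} [Fintype m₁] [Fintype m₂]
    [Fintype n₁] [Fintype n₂] {E : Matrix m₁ m₂ ℂ →ₗ[ℂ] Matrix n₁ n₂ ℂ}
    {L : Matrix n₁ n₁ ℂ} {R : Matrix n₂ n₂ ℂ} {A : Matrix m₁ m₁ ℂ} {B : Matrix m₂ m₂ ℂ}
    (hL : L.IsHermitian) (hR : R.IsHermitian) (hA : A.PosSemidef) (hB : B.PosSemidef)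
    (hLA : ∀ X, ((L * E X)ᴴ * (L * E X)).trace.re ≤ ((A * X)ᴴ * (A * X)).trace.re)
    (hRB : ∀ X, ((E X * R)ᴴ * (E X * R)).trace.re ≤ ((X * B)ᴴ * (X * B)).trace.re)
    (X : Matrix m₁ m₂ ℂ) :
    ((E X)ᴴ * (L * E X * R)).trace.re ≤ (Xᴴ * (A * X * B)).trace.re := by
  simpa only [inner_eq_trace, mulLeftLinearMap_apply, mulRightLinearMap_apply, Matrix.mul_assoc]
    using! re_inner_mul_le_re_inner_mul (V := E) (isSymmetric_mulLeft hL) (isSymmetric_mulRight hR)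
      (commute_mulLeftLinearMap_mulRightLinearMap L R) (isPositive_mulLeft hA)
      (isPositive_mulRight hB) (commute_mulLeftLinearMap_mulRightLinearMap A B)
      (fun Y => frobenius_norm_le_iff.2 (hLA Y)) (fun Y => frobenius_norm_le_iff.2 (hRB Y)) X

theorem hsNorm_sq (X : Matrix n n ℂ) : hsNorm X ^ 2 = (Xᴴ * X).trace.re :=
  Real.sq_sqrt (frobenius_norm_sq X ▸ sq_nonneg _)

theorem hsNorm_smul_mul_sq [DecidableEq n] {U : Matrix n n ℂ} (hU : Uᴴ * U = 1) (s : ℝ)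
    (X : Matrix n n ℂ) : hsNorm ((s : ℂ) • (U * X)) ^ 2 = s ^ 2 * hsNorm X ^ 2 := by
  have hUX : (U * X)ᴴ * (U * X) = Xᴴ * X := by
    rw [conjTranspose_mul, Matrix.mul_assoc, ← Matrix.mul_assoc Uᴴ, hU, Matrix.one_mul]
  rw [hsNorm_sq, hsNorm_sq, conjTranspose_smul, smul_mul_smul_comm, hUX, trace_smul, smul_eq_mul,
    Complex.star_def, Complex.conj_ofReal, ← Complex.ofReal_mul, Complex.re_ofReal_mul, sq]

end HilbertSchmidt

/-! ### Completely positive maps in Kraus form -/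

section Kraus

variable {κ m n : Type*} [Fintype κ] [Fintype n]

/-- The completely positive map `X ↦ ∑ₖ Vₖ X Vₖ†` with Kraus operators `V`. Its dual for the trace
pairing is the map with Kraus operators `Vₖ†`. -/
noncomputable def krausMap (V : κ → Matrix m n ℂ) : Matrix n n ℂ →ₗ[ℂ] Matrix m m ℂ :=
  ∑ k, mulRightLinearMap m ℂ (V k)ᴴ ∘ₗ mulLeftLinearMap n ℂ (V k)

theorem krausMap_apply (V : κ → Matrix m n ℂ) (X : Matrix n n ℂ) :
    krausMap V X = ∑ k, V k * X * (V k)ᴴ := by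
  simp [krausMap]

theorem krausMap_conjTranspose (V : κ → Matrix m n ℂ) (X : Matrix n n ℂ) :
    krausMap V Xᴴ = (krausMap V X)ᴴ := by
  simp only [krausMap_apply, conjTranspose_sum, conjTranspose_mul, conjTranspose_conjTranspose,
    Matrix.mul_assoc]

theorem posSemidef_krausMap [Finite m] (V : κ → Matrix m n ℂ) {X : Matrix n n ℂ}
    (hX : X.PosSemidef) : (krausMap V X).PosSemidef := by
  rw [krausMap_apply]
  exact posSemidef_sum _ fun k _ => hX.mul_mul_conjTranspose_same (V k)

variable [Fintype m]

theorem trace_mul_krausMap (V : κ → Matrix m n ℂ) (X : Matrix n n ℂ) (Y : Matrix m m ℂ) :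
    (Y * krausMap V X).trace = (krausMap (fun k => (V k)ᴴ) Y * X).trace := by
  simp only [krausMap_apply, conjTranspose_conjTranspose, Matrix.mul_sum, Matrix.sum_mul,
    trace_sum]
  refine Finset.sum_congr rfl fun k _ => ?_
  rw [← Matrix.mul_assoc, trace_mul_comm]
  simp only [Matrix.mul_assoc]

variable [DecidableEq m] [DecidableEq n]

theorem kadison_schwarz {V : κ → Matrix m n ℂ} (hV : krausMap V 1 = 1) (X : Matrix n n ℂ) :
    (krausMap V (Xᴴ * X) - (krausMap V X)ᴴ * krausMap V X).PosSemidef := by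
  set E := krausMap V X with hE
  have hVV : ∑ k, V k * (V k)ᴴ = 1 := by
    rw [← hV, krausMap_apply]; simp only [Matrix.mul_one]
  have hsum : krausMap V (Xᴴ * X) - Eᴴ * E =
      ∑ k, (X * (V k)ᴴ - (V k)ᴴ * E)ᴴ * (X * (V k)ᴴ - (V k)ᴴ * E) := by
    have hterm (k : κ) : (X * (V k)ᴴ - (V k)ᴴ * E)ᴴ * (X * (V k)ᴴ - (V k)ᴴ * E) =
        V k * (Xᴴ * X) * (V k)ᴴ - V k * Xᴴ * (V k)ᴴ * E - Eᴴ * (V k * X * (V k)ᴴ) +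
          Eᴴ * (V k * (V k)ᴴ) * E := by
      simp only [conjTranspose_sub, conjTranspose_mul, conjTranspose_conjTranspose, Matrix.sub_mul,
        Matrix.mul_sub, Matrix.mul_assoc]
      abel
    simp only [hterm, Finset.sum_add_distrib, Finset.sum_sub_distrib, ← Matrix.mul_sum,
      ← Matrix.sum_mul, hVV, ← krausMap_apply, krausMap_conjTranspose, ← hE, Matrix.mul_one]
    abel
  rw [hsum]
  exact posSemidef_sum _ fun k _ => posSemidef_conjTranspose_mul_self _

theorem krausMap_dual_one {V : κ → Matrix m n ℂ} (hV : ∀ X, (krausMap V X).trace = X.trace) :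
    krausMap (fun k => (V k)ᴴ) 1 = 1 := by
  rw [ext_iff_trace_mul_right]
  intro X
  rw [← trace_mul_krausMap, Matrix.one_mul, Matrix.one_mul, hV]

end Kraus

section Choi

variable {m n : Type*} [DecidableEq n]

/-- The Choi matrix of a linear map between matrix algebras, which is positive semidefinite for
completely positive maps. The input index comes first, as in `idTensor`. -/
def choiMatrix (Φ : Matrix n n ℂ →ₗ[ℂ] Matrix m m ℂ) : Matrix (n × m) (n × m) ℂ :=
  of fun p q => Φ (single p.1 q.1 1) p.2 q.2

variable [Fintype m] [Fintype n]

theorem IsCPTP.posSemidef_choiMatrix {Φ : Matrix n n ℂ →ₗ[ℂ] Matrix m m ℂ} (hΦ : IsCPTP Φ) :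
    (choiMatrix Φ).PosSemidef := by
  let e := Fintype.equivFin n
  let w : Fin (Fintype.card n) × n → ℂ := fun p => if p.1 = e p.2 then 1 else 0
  have hchoi : choiMatrix Φ =
      (idTensor (Fin (Fintype.card n)) Φ (vecMulVec w (star w))).submatrix
        (Prod.map e id) (Prod.map e id) := by
    ext ⟨i, p⟩ ⟨j, q⟩
    refine congrArg (fun X => Φ X p q) ?_
    ext i' j'
    simp [w, single_apply, vecMulVec_apply, ← ite_and, and_comm]
  rw [hchoi]
  exact (hΦ.completelyPositive _ _ (posSemidef_vecMulVec_self_star w)).submatrix _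

theorem exists_eq_krausMap_of_posSemidef_choiMatrix {Φ : Matrix n n ℂ →ₗ[ℂ] Matrix m m ℂ}
    (hΦ : (choiMatrix Φ).PosSemidef) : ∃ V : n × m → Matrix m n ℂ, Φ = krausMap V := by
  classical
  obtain ⟨B, hB⟩ := CStarAlgebra.nonneg_iff_eq_star_mul_self.1 hΦ.nonneg
  refine ⟨fun k => of fun p i => star (B k (i, p)),
    ext_linearMap ℂ fun i j => LinearMap.ext_ring <| Matrix.ext fun p q => ?_⟩
  have hentry : choiMatrix Φ (i, p) (j, q) = ∑ k, star (B k (i, p)) * B k (j, q) := by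
    rw [hB, mul_apply]; rfl
  simpa [krausMap_apply, Matrix.sum_apply, mul_apply, single_apply, ite_and] using! hentry

theorem IsCPTP.exists_eq_krausMap [DecidableEq m] {Φ : Matrix n n ℂ →ₗ[ℂ] Matrix m m ℂ}
    (hΦ : IsCPTP Φ) :
    ∃ V : n × m → Matrix m n ℂ, Φ = krausMap V ∧ krausMap (fun k => (V k)ᴴ) 1 = 1 := by
  obtain ⟨V, rfl⟩ := exists_eq_krausMap_of_posSemidef_choiMatrix hΦ.posSemidef_choiMatrix
  exact ⟨V, rfl, krausMap_dual_one hΦ.tracePreserving⟩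

end Choi

section IdTensor

variable {a b c : Type*}

theorem idTensor_kronecker (Φ : Matrix b b ℂ →ₗ[ℂ] Matrix c c ℂ) (A : Matrix a a ℂ)
    (B : Matrix b b ℂ) : idTensor a Φ (A ⊗ₖ B) = A ⊗ₖ Φ B := by
  ext ⟨i, p⟩ ⟨j, q⟩
  have hblock : of (fun k l => (A ⊗ₖ B) (i, k) (j, l)) = A i j • B := rfl
  rw [idTensor, of_apply, hblock, map_smul, Matrix.smul_apply, smul_eq_mul, kroneckerMap_apply]

theorem idTensor_krausMap [Fintype a] [DecidableEq a] [Fintype b] {κ : Type*} [Fintype κ]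
    (V : κ → Matrix c b ℂ) (X : Matrix (a × b) (a × b) ℂ) :
    idTensor a (krausMap V) X = krausMap (fun k => (1 : Matrix a a ℂ) ⊗ₖ V k) X := by
  ext ⟨i, p⟩ ⟨j, q⟩
  simp only [idTensor, of_apply, krausMap_apply, Matrix.sum_apply, mul_apply,
    conjTranspose_kronecker, conjTranspose_one, kroneckerMap_apply, Fintype.sum_prod_type,
    one_apply, conjTranspose_apply, ite_mul, one_mul, zero_mul, mul_ite, mul_zero,
    Finset.sum_ite_irrel, Finset.sum_const_zero, Finset.sum_ite_eq, Finset.sum_ite_eq',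
    Finset.mem_univ, if_true]

theorem posSemidef_idTensor [Finite a] [Fintype b] [Fintype c]
    {Φ : Matrix b b ℂ →ₗ[ℂ] Matrix c c ℂ} (hΦ : IsCPTP Φ) {ρ : Matrix (a × b) (a × b) ℂ}
    (hρ : ρ.PosSemidef) : (idTensor a Φ ρ).PosSemidef := by
  classical
  cases nonempty_fintype a
  obtain ⟨V, rfl, -⟩ := hΦ.exists_eq_krausMap
  rw [idTensor_krausMap]
  exact posSemidef_krausMap _ hρ

end IdTensor

/-! ### The Wigner–Yanase skew information -/

section SkewInformation

variable {m n : Type*} [Fintype m] [Fintype n]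

theorem re_trace_mul_nonneg {A B : Matrix n n ℂ} (hA : A.PosSemidef) (hB : B.PosSemidef) :
    0 ≤ (A * B).trace.re := by
  classical
  obtain ⟨C, rfl⟩ := CStarAlgebra.nonneg_iff_eq_star_mul_self.1 hB.nonneg
  rw [← Matrix.mul_assoc, trace_mul_comm, ← Matrix.mul_assoc]
  exact (Complex.nonneg_iff.1 (hA.mul_mul_conjTranspose_same C).trace_nonneg).1

variable [DecidableEq m] [DecidableEq n]

theorem posSemidef_sqrt (A : Matrix n n ℂ) : (CFC.sqrt A).PosSemidef :=
  nonneg_iff_posSemidef.1 (CFC.sqrt_nonneg A)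

theorem sqrt_mul_sqrt {A : Matrix n n ℂ} (hA : A.PosSemidef) : CFC.sqrt A * CFC.sqrt A = A :=
  CFC.sqrt_mul_sqrt_self A hA.nonneg

theorem trace_conjTranspose_mul_self_mul_sqrt {ρ : Matrix n n ℂ} (hρ : ρ.PosSemidef)
    (X : Matrix n n ℂ) :
    ((X * CFC.sqrt ρ)ᴴ * (X * CFC.sqrt ρ)).trace = (Xᴴ * X * ρ).trace := by
  rw [conjTranspose_mul, (posSemidef_sqrt ρ).isHermitian.eq, Matrix.mul_assoc, trace_mul_comm,
    Matrix.mul_assoc, Matrix.mul_assoc, sqrt_mul_sqrt hρ, ← Matrix.mul_assoc]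

theorem trace_conjTranspose_mul_self_sqrt_mul {ρ : Matrix n n ℂ} (hρ : ρ.PosSemidef)
    (X : Matrix n n ℂ) :
    ((CFC.sqrt ρ * X)ᴴ * (CFC.sqrt ρ * X)).trace = (X * Xᴴ * ρ).trace := by
  rw [conjTranspose_mul, (posSemidef_sqrt ρ).isHermitian.eq, Matrix.mul_assoc,
    ← Matrix.mul_assoc _ _ X, sqrt_mul_sqrt hρ, ← Matrix.mul_assoc, trace_mul_cycle]

/-- The Wigner–Yanase skew information `tr (K† K ρ) - tr (K† √ρ K √ρ)`. It is defined for every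
`K` so that it can be evaluated at `A ⊗ 1` for arbitrary `A`; for Hermitian `K` it is half the
squared Hilbert–Schmidt norm of the commutator of `K` and `√ρ`. -/
noncomputable def skewInformation (ρ K : Matrix n n ℂ) : ℝ :=
  (Kᴴ * K * ρ).trace.re - (Kᴴ * (CFC.sqrt ρ * K * CFC.sqrt ρ)).trace.re

theorem hsNorm_sub_sq_eq_skewInformation {ρ K : Matrix n n ℂ} (hρ : ρ.PosSemidef)
    (hK : K.IsHermitian) :
    hsNorm (K * CFC.sqrt ρ - CFC.sqrt ρ * K) ^ 2 = 2 * skewInformation ρ K := by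
  have hR : (CFC.sqrt ρ)ᴴ = CFC.sqrt ρ := (posSemidef_sqrt ρ).isHermitian.eq
  have hKR := trace_conjTranspose_mul_self_mul_sqrt hρ K
  have hRK := trace_conjTranspose_mul_self_sqrt_mul hρ K
  have hcross₁ : ((K * CFC.sqrt ρ)ᴴ * (CFC.sqrt ρ * K)).trace =
      (Kᴴ * (CFC.sqrt ρ * K * CFC.sqrt ρ)).trace := by
    rw [conjTranspose_mul, hR, Matrix.mul_assoc, trace_mul_comm]
    simp only [Matrix.mul_assoc]
  have hcross₂ : ((CFC.sqrt ρ * K)ᴴ * (K * CFC.sqrt ρ)).trace =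
      (Kᴴ * (CFC.sqrt ρ * K * CFC.sqrt ρ)).trace := by
    rw [conjTranspose_mul, hR]
    simp only [Matrix.mul_assoc]
  rw [hK.eq] at hRK
  rw [hsNorm_sq, skewInformation, conjTranspose_sub, Matrix.sub_mul, Matrix.mul_sub, Matrix.mul_sub,
    trace_sub, trace_sub, trace_sub, hKR, hRK, hcross₁, hcross₂, hK.eq]
  simp only [Complex.sub_re]
  ring

theorem sqrt_kronecker {A : Matrix m m ℂ} {B : Matrix n n ℂ} (hA : A.PosSemidef)
    (hB : B.PosSemidef) : CFC.sqrt (A ⊗ₖ B) = CFC.sqrt A ⊗ₖ CFC.sqrt B :=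
  CFC.sqrt_unique (by rw [← mul_kronecker_mul, sqrt_mul_sqrt hA, sqrt_mul_sqrt hB])
    ((posSemidef_sqrt A).kronecker (posSemidef_sqrt B)).nonneg

theorem skewInformation_kronecker {A : Matrix m m ℂ} {B : Matrix n n ℂ} (hA : A.PosSemidef)
    (hB : B.PosSemidef) (K : Matrix m m ℂ) :
    skewInformation (A ⊗ₖ B) (K ⊗ₖ (1 : Matrix n n ℂ)) = B.trace.re * skewInformation A K := by
  have hB_im : B.trace.im = 0 := (Complex.nonneg_iff.1 hB.trace_nonneg).2.symm
  simp only [skewInformation, sqrt_kronecker hA hB, conjTranspose_kronecker, conjTranspose_one,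
    ← mul_kronecker_mul, Matrix.one_mul, Matrix.mul_one, sqrt_mul_sqrt hB, trace_kronecker,
    Complex.mul_re, hB_im]
  ring

variable {κ : Type*} [Fintype κ] {V : κ → Matrix m n ℂ}

theorem re_trace_krausMap_dual_le (hV : krausMap (fun k => (V k)ᴴ) 1 = 1)
    {ρ : Matrix n n ℂ} (hρ : ρ.PosSemidef) (X : Matrix m m ℂ) :
    ((krausMap (fun k => (V k)ᴴ) X)ᴴ * krausMap (fun k => (V k)ᴴ) X * ρ).trace.re ≤
      (Xᴴ * X * krausMap V ρ).trace.re := by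
  have hnonneg := re_trace_mul_nonneg (kadison_schwarz hV X) hρ
  rwa [Matrix.sub_mul, trace_sub, Complex.sub_re, sub_nonneg, ← trace_mul_krausMap] at hnonneg

/-- Lieb's inequality with exponent `1/2`. -/
theorem re_trace_krausMap_dual_mul_sqrt_le (hV : krausMap (fun k => (V k)ᴴ) 1 = 1)
    {ρ : Matrix n n ℂ} (hρ : ρ.PosSemidef) (X : Matrix m m ℂ) :
    ((krausMap (fun k => (V k)ᴴ) X)ᴴ *
      (CFC.sqrt ρ * krausMap (fun k => (V k)ᴴ) X * CFC.sqrt ρ)).trace.re ≤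
      (Xᴴ * (CFC.sqrt (krausMap V ρ) * X * CFC.sqrt (krausMap V ρ))).trace.re := by
  have hσ : (krausMap V ρ).PosSemidef := posSemidef_krausMap V hρ
  refine re_trace_conjTranspose_mul_mul_mul_le (posSemidef_sqrt ρ).isHermitian
    (posSemidef_sqrt ρ).isHermitian (posSemidef_sqrt _) (posSemidef_sqrt _) (fun Y => ?_)
    (fun Y => ?_) X
  · rw [trace_conjTranspose_mul_self_sqrt_mul hρ, trace_conjTranspose_mul_self_sqrt_mul hσ]
    simpa only [krausMap_conjTranspose, conjTranspose_conjTranspose] using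
      re_trace_krausMap_dual_le hV hρ Yᴴ
  · rw [trace_conjTranspose_mul_self_mul_sqrt hρ, trace_conjTranspose_mul_self_mul_sqrt hσ]
    exact re_trace_krausMap_dual_le hV hρ Y

theorem skewInformation_krausMap_le (hV : krausMap (fun k => (V k)ᴴ) 1 = 1)
    {ρ : Matrix n n ℂ} (hρ : ρ.PosSemidef) {K : Matrix m m ℂ} {K' : Matrix n n ℂ}
    (hK : krausMap (fun k => (V k)ᴴ) K = K')
    (hKK : krausMap (fun k => (V k)ᴴ) (Kᴴ * K) = K'ᴴ * K') :
    skewInformation (krausMap V ρ) K ≤ skewInformation ρ K' := by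
  have hlieb := re_trace_krausMap_dual_mul_sqrt_le hV hρ K
  rw [hK] at hlieb
  rw [skewInformation, skewInformation, trace_mul_krausMap, hKK]
  linarith

theorem skewInformation_idTensor_le {a b c : Type*} [Fintype a] [DecidableEq a] [Fintype b]
    [DecidableEq b] [Fintype c] [DecidableEq c] {Φ : Matrix b b ℂ →ₗ[ℂ] Matrix c c ℂ}
    (hΦ : IsCPTP Φ) {ρ : Matrix (a × b) (a × b) ℂ} (hρ : ρ.PosSemidef) (K : Matrix a a ℂ) :
    skewInformation (idTensor a Φ ρ) (K ⊗ₖ (1 : Matrix c c ℂ)) ≤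
      skewInformation ρ (K ⊗ₖ (1 : Matrix b b ℂ)) := by
  obtain ⟨V, rfl, hV⟩ := hΦ.exists_eq_krausMap
  have hfix (A : Matrix a a ℂ) :
      krausMap (fun k => ((1 : Matrix a a ℂ) ⊗ₖ V k)ᴴ) (A ⊗ₖ (1 : Matrix c c ℂ)) =
        A ⊗ₖ (1 : Matrix b b ℂ) := by
    simp only [conjTranspose_kronecker, conjTranspose_one, ← idTensor_krausMap,
      idTensor_kronecker, hV]
  rw [idTensor_krausMap]
  refine skewInformation_krausMap_le ?_ hρ (hfix K) ?_
  · simpa only [one_kronecker_one] using hfix 1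
  · simpa only [conjTranspose_kronecker, conjTranspose_one, ← mul_kronecker_mul, Matrix.mul_one]
      using hfix (Kᴴ * K)

end SkewInformation

section Marginals

variable {a b : Type*}

theorem posSemidef_marginalA [Fintype b] {ρ : Matrix (a × b) (a × b) ℂ} (hρ : ρ.PosSemidef) :
    (marginalA ρ).PosSemidef := by
  have hsum : marginalA ρ = ∑ j, ρ.submatrix (·, j) (·, j) := by
    ext i i'
    simp only [marginalA, of_apply, Matrix.sum_apply, submatrix_apply]
  rw [hsum]
  exact posSemidef_sum _ fun j _ => hρ.submatrix _

theorem posSemidef_marginalB [Fintype a] {ρ : Matrix (a × b) (a × b) ℂ} (hρ : ρ.PosSemidef) :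
    (marginalB ρ).PosSemidef := by
  have hsum : marginalB ρ = ∑ i, ρ.submatrix (i, ·) (i, ·) := by
    ext j j'
    simp only [marginalB, of_apply, Matrix.sum_apply, submatrix_apply]
  rw [hsum]
  exact posSemidef_sum _ fun i _ => hρ.submatrix _

theorem marginalA_idTensor {c : Type*} [Fintype b] [Fintype c]
    {Φ : Matrix b b ℂ →ₗ[ℂ] Matrix c c ℂ} (hΦ : ∀ X, (Φ X).trace = X.trace)
    (ρ : Matrix (a × b) (a × b) ℂ) : marginalA (idTensor a Φ ρ) = marginalA ρ := by
  ext i i'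
  exact hΦ (of fun j j' => ρ (i, j) (i', j'))

variable [Fintype a] [Fintype b]

theorem trace_marginalA (ρ : Matrix (a × b) (a × b) ℂ) : (marginalA ρ).trace = ρ.trace := by
  simp [trace, marginalA, Fintype.sum_prod_type]

theorem trace_marginalB (ρ : Matrix (a × b) (a × b) ℂ) : (marginalB ρ).trace = ρ.trace := by
  simp [trace, marginalB, Fintype.sum_prod_type_right]

end Marginals

/-! ### The coherence of a weak measurement -/

theorem tau1_sq_add_tau2_sq (x : ℝ) : tau1 x ^ 2 + tau2 x ^ 2 = 1 := by
  have hx := abs_lt.1 (Real.abs_tanh_lt_one x)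
  rw [tau1, tau2, Real.sq_sqrt (by linarith), Real.sq_sqrt (by linarith)]
  ring

section Coherence

variable {a b : Type*} [Fintype a] [Fintype b] [DecidableEq b] {P Q : Matrix a a ℂ}

theorem isStarProjection_kronecker_one (h : IsStarProjection P) :
    IsStarProjection (P ⊗ₖ (1 : Matrix b b ℂ)) where
  isIdempotentElem := by
    rw [IsIdempotentElem, ← mul_kronecker_mul, h.isIdempotentElem.eq, Matrix.one_mul]
  isSelfAdjoint := by
    rw [IsSelfAdjoint, star_eq_conjTranspose, conjTranspose_kronecker, conjTranspose_one,
      ← star_eq_conjTranspose, h.isSelfAdjoint.star_eq]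

variable [DecidableEq a] {ρ : Matrix (a × b) (a × b) ℂ}

theorem sub_weakMeasure (x : ℝ) (h : IsProjectorPair P Q) (X : Matrix (a × b) (a × b) ℂ) :
    X - weakMeasure x P Q X = ((1 - 2 * tau1 x * tau2 x : ℝ) : ℂ) •
      ((2 * P ⊗ₖ (1 : Matrix b b ℂ) - 1) *
        (P ⊗ₖ (1 : Matrix b b ℂ) * X - X * P ⊗ₖ (1 : Matrix b b ℂ))) := by
  have hτ : (tau1 x : ℂ) ^ 2 + (tau2 x : ℂ) ^ 2 = 1 := by exact_mod_cast tau1_sq_add_tau2_sq x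
  have hQ : Q ⊗ₖ (1 : Matrix b b ℂ) = 1 - P ⊗ₖ (1 : Matrix b b ℂ) := by
    rw [eq_sub_iff_add_eq', ← add_kronecker, h.add_eq_one, one_kronecker_one]
  have hP := (isStarProjection_kronecker_one (b := b) h.left_proj).isIdempotentElem.eq
  simp only [weakMeasure, weakPlus, weakMinus, add_kronecker, smul_kronecker, hQ]
  generalize P ⊗ₖ (1 : Matrix b b ℂ) = p at *
  have hp (Y : Matrix (a × b) (a × b) ℂ) : p * (p * Y) = p * Y := by rw [← Matrix.mul_assoc, hP]
  simp only [Matrix.add_mul, Matrix.mul_add, Matrix.sub_mul, Matrix.mul_sub, Matrix.smul_mul,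
    Matrix.mul_smul, Matrix.one_mul, Matrix.mul_one, Matrix.mul_assoc, two_mul, hp]
  push_cast
  linear_combination (norm := module) (-hτ) • (X - X * p - p * X + (2 : ℂ) • (p * (X * p)))

theorem coherence_eq (x : ℝ) (h : IsProjectorPair P Q) (hρ : ρ.PosSemidef) :
    coherence x P Q ρ = 2 * (1 - 2 * tau1 x * tau2 x) ^ 2 *
      skewInformation ρ (P ⊗ₖ (1 : Matrix b b ℂ)) := by
  have hP := isStarProjection_kronecker_one (b := b) h.left_proj
  rw [coherence, sub_weakMeasure x h,
    hsNorm_smul_mul_sq (Unitary.star_mul_self_of_mem hP.two_mul_sub_one_mem_unitary),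
    hsNorm_sub_sq_eq_skewInformation hρ hP.isSelfAdjoint]
  ring

theorem Delta_eq (x : ℝ) (h : IsProjectorPair P Q) (hρ : ρ.PosSemidef) :
    Delta x P Q ρ = 2 * (1 - 2 * tau1 x * tau2 x) ^ 2 *
      (skewInformation ρ (P ⊗ₖ (1 : Matrix b b ℂ)) -
        ρ.trace.re * skewInformation (marginalA ρ) P) := by
  have hA := posSemidef_marginalA hρ
  have hB := posSemidef_marginalB hρ
  rw [Delta, coherence_eq x h hρ, coherence_eq x h (hA.kronecker hB),
    skewInformation_kronecker hA hB, trace_marginalB, ← mul_sub]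

theorem Delta_idTensor_le {c : Type*} [Fintype c] [DecidableEq c] (x : ℝ)
    (h : IsProjectorPair P Q) {Φ : Matrix b b ℂ →ₗ[ℂ] Matrix c c ℂ} (hΦ : IsCPTP Φ)
    (hρ : ρ.PosSemidef) : Delta x P Q (idTensor a Φ ρ) ≤ Delta x P Q ρ := by
  have hmarginal := marginalA_idTensor hΦ.tracePreserving ρ
  have htrace : (idTensor a Φ ρ).trace = ρ.trace := by
    rw [← trace_marginalA, hmarginal, trace_marginalA]
  rw [Delta_eq x h (posSemidef_idTensor hΦ hρ), Delta_eq x h hρ, hmarginal, htrace]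
  gcongr
  exact skewInformation_idTensor_le hΦ hρ P

end Coherence

/-! ### Attainment of the minimum -/

section Attainment

variable (a : Type*) [Fintype a]

theorem isCompact_nonzero_isStarProjection :
    IsCompact {P : Matrix a a ℂ | IsStarProjection P ∧ P ≠ 0} := by
  classical
  open scoped Matrix.Norms.L2Operator in
  have : ProperSpace (Matrix a a ℂ) := FiniteDimensional.proper ℂ _
  have hnorm {P : Matrix a a ℂ} (hP : IsStarProjection P) (hP0 : P ≠ 0) : ‖P‖ = 1 := by
    have hsq := CStarRing.norm_star_mul_self (x := P)
    rw [hP.isSelfAdjoint.star_eq, hP.isIdempotentElem.eq] at hsq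
    exact (mul_eq_left₀ (norm_ne_zero_iff.2 hP0)).1 hsq.symm
  have hset : {P : Matrix a a ℂ | IsStarProjection P ∧ P ≠ 0} =
      Metric.sphere 0 1 ∩ {P | P * P = P ∧ star P = P} := by
    ext P
    rw [Set.mem_inter_iff, mem_sphere_zero_iff_norm]
    refine ⟨fun h => ⟨hnorm h.1 h.2, h.1.isIdempotentElem, h.1.isSelfAdjoint⟩, fun h =>
      ⟨⟨h.2.1, h.2.2⟩, norm_ne_zero_iff.1 (h.1 ▸ one_ne_zero)⟩⟩
  rw [hset]
  exact (isCompact_sphere _ _).inter_right ((isClosed_eq (by fun_prop) continuous_id).inter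
    (isClosed_eq continuous_star continuous_id))

variable [DecidableEq a]

theorem isCompact_isProjectorPair :
    IsCompact {p : Matrix a a ℂ × Matrix a a ℂ | IsProjectorPair p.1 p.2} := by
  have hset : {p : Matrix a a ℂ × Matrix a a ℂ | IsProjectorPair p.1 p.2} =
      ({P | IsStarProjection P ∧ P ≠ 0} ×ˢ {Q | IsStarProjection Q ∧ Q ≠ 0}) ∩
        {p | p.1 + p.2 = 1} := by
    ext p
    exact ⟨fun h => ⟨⟨⟨h.left_proj, h.left_ne_zero⟩, h.right_proj, h.right_ne_zero⟩, h.add_eq_one⟩,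
      fun ⟨⟨⟨hP, hP0⟩, hQ, hQ0⟩, hPQ⟩ => ⟨hP, hQ, hPQ, hP0, hQ0⟩⟩
  rw [hset]
  have hcompact := isCompact_nonzero_isStarProjection a
  exact (hcompact.prod hcompact).inter_right
    (isClosed_eq (continuous_fst.add continuous_snd) continuous_const)

theorem exists_isProjectorPair [Nontrivial a] : ∃ P Q : Matrix a a ℂ, IsProjectorPair P Q := by
  obtain ⟨i, j, hij⟩ := exists_pair_ne a
  have hP : IsStarProjection (single i i (1 : ℂ)) :=
    ⟨by simp [IsIdempotentElem], by simp [IsSelfAdjoint, star_eq_conjTranspose]⟩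
  refine ⟨single i i 1, 1 - single i i 1, hP, hP.one_sub, by abel, fun h => ?_, fun h => ?_⟩
  · simpa using congrFun (congrFun h i) i
  · simpa [hij] using congrFun (congrFun h j) j

end Attainment

section Minimum

variable {a b : Type*} [Fintype a] [Fintype b] [DecidableEq b]

theorem continuous_weakMeasure (x : ℝ) (X : Matrix (a × b) (a × b) ℂ) :
    Continuous fun p : Matrix a a ℂ × Matrix a a ℂ => weakMeasure x p.1 p.2 X := by
  have hkronecker : Continuous fun P : Matrix a a ℂ => P ⊗ₖ (1 : Matrix b b ℂ) :=
    continuous_matrix fun p q => (continuous_id.matrix_elem p.1 q.1).mul continuous_const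
  unfold weakMeasure weakPlus weakMinus
  fun_prop

variable [DecidableEq a]

theorem continuous_coherence (x : ℝ) (ρ : Matrix (a × b) (a × b) ℂ) :
    Continuous fun p : Matrix a a ℂ × Matrix a a ℂ => coherence x p.1 p.2 ρ := by
  have hweak := continuous_weakMeasure x (CFC.sqrt ρ)
  simp only [coherence, hsNorm_sq]
  fun_prop

theorem isLeast_Qw [Nontrivial a] (x : ℝ) (ρ : Matrix (a × b) (a × b) ℂ) :
    IsLeast (DeltaValues x ρ) (Qw x ρ) := by
  have himage : DeltaValues x ρ = (fun p : Matrix a a ℂ × Matrix a a ℂ => Delta x p.1 p.2 ρ) ''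
      {p | IsProjectorPair p.1 p.2} :=
    Set.ext fun r => ⟨fun ⟨P, Q, h, hr⟩ => ⟨(P, Q), h, hr.symm⟩,
      fun ⟨p, h, hr⟩ => ⟨p.1, p.2, h, hr.symm⟩⟩
  have hcont : Continuous fun p : Matrix a a ℂ × Matrix a a ℂ => Delta x p.1 p.2 ρ :=
    (continuous_coherence x ρ).sub (continuous_coherence x _)
  obtain ⟨P, Q, h⟩ := exists_isProjectorPair a
  rw [Qw, himage]
  exact ((isCompact_isProjectorPair a).image hcont).isLeast_sInf ⟨_, (P, Q), h, rfl⟩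

end Minimum

end WeakCorrelation

open scoped ComplexOrder in
theorem mainTheorem9_general {a b c : Type*} [Fintype a] [DecidableEq a] [Nontrivial a]
    [Fintype b] [DecidableEq b] [Fintype c] [DecidableEq c] (x : ℝ)
    (ρ : Matrix (a × b) (a × b) ℂ) (hρ : ρ.PosSemidef)
    (Φ : Matrix b b ℂ →ₗ[ℂ] Matrix c c ℂ) (hΦ : WeakCorrelation.IsCPTP Φ) :
    IsLeast (WeakCorrelation.DeltaValues x ρ) (WeakCorrelation.Qw x ρ) ∧
    IsLeast (WeakCorrelation.DeltaValues x (WeakCorrelation.idTensor a Φ ρ))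
      (WeakCorrelation.Qw x (WeakCorrelation.idTensor a Φ ρ)) ∧
    WeakCorrelation.Qw x (WeakCorrelation.idTensor a Φ ρ) ≤ WeakCorrelation.Qw x ρ := by
  have hmin := WeakCorrelation.isLeast_Qw x ρ
  have hmin' := WeakCorrelation.isLeast_Qw x (WeakCorrelation.idTensor a Φ ρ)
  refine ⟨hmin, hmin', ?_⟩
  obtain ⟨P, Q, hPQ, hQw⟩ := hmin.1
  calc WeakCorrelation.Qw x (WeakCorrelation.idTensor a Φ ρ)
      ≤ WeakCorrelation.Delta x P Q (WeakCorrelation.idTensor a Φ ρ) := hmin'.2 ⟨P, Q, hPQ, rfl⟩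
    _ ≤ WeakCorrelation.Delta x P Q ρ := WeakCorrelation.Delta_idTensor_le x hPQ hΦ hρ
    _ = WeakCorrelation.Qw x ρ := hQw.symm

/-- The quantum correlation `Q_w` (whose defining minima are attained) does not increase under a
CPTP map acting on subsystem `b`. -/
theorem mainTheorem9 {a b c : Type*} [Fintype a] [DecidableEq a] [Nontrivial a]
    [Fintype b] [DecidableEq b] [Fintype c] [DecidableEq c] (x : ℝ)
    (ρ : Matrix (a × b) (a × b) ℂ) (hρ : WeakCorrelation.IsState ρ)
    (Φ : Matrix b b ℂ →ₗ[ℂ] Matrix c c ℂ) (hΦ : WeakCorrelation.IsCPTP Φ) :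
    IsLeast (WeakCorrelation.DeltaValues x ρ) (WeakCorrelation.Qw x ρ) ∧
    IsLeast (WeakCorrelation.DeltaValues x (WeakCorrelation.idTensor a Φ ρ))
      (WeakCorrelation.Qw x (WeakCorrelation.idTensor a Φ ρ)) ∧
    WeakCorrelation.Qw x (WeakCorrelation.idTensor a Φ ρ) ≤ WeakCorrelation.Qw x ρ :=
  mainTheorem9_general x ρ hρ.1 Φ hΦ
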